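/- For $n\ge 3$, let $\Sigma$ be the set of width-$2$ simple permutations of $\{0,1\}^n$, i.e. of the permutations $f_{i,(j_1,j_2),h}$ with $i,j_1,j_2\in\{1,\dots,n\}$ distinct and $h:\{0,1\}^2\to\{0,1\}$, where $f_{i,(j_1,j_2),h}$ maps $(x_1,\dots,x_n)$ to $(x_1,\dots,x_{i-1},x_i\oplus h(x_{j_1},x_{j_2}),x_{i+1},\dots,x_n)$. A length-$L$ randomized implementation of a permutation $\sigma$ is a sequence of (jointly distributed) random permutations $\sigma_1,\dots,\sigma_L\in\Sigma$ whose composition is always $\sigma$. Permutations act on the right: $x\sigma_1\cdots\sigma_\ell$ is obtained from $x$ by applying $\sigma_1$ first, and the $3$-cycle $(xyz)$ maps $x\mapsto y\mapsto z\mapsto x$. The min-entropy of a discrete random variable $X$ is $H_\infty(X)=\min_{\chi}\bigl(-\log_2\Pr[X=\chi]\bigr)$. There are absolute constants $A,B$ such that for every $n\ge 3$ there is a length $L\le A\,n$ and, for all distinct $x,y,z\in\{0,1\}^n$, a length-$L$ randomized implementation $\sigma_1,\dots,\sigma_L$ of the $3$-cycle $(xyz)$ with the following property. If $(x,y,z)$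 is uniformly distributed over the triples of distinct elements of $\{0,1\}^n$ and $\sigma_1,\dots,\sigma_L$ is then drawn from the randomized implementation of $(xyz)$, then for every $\ell\in\{1,\dots,L\}$ the random variable $(x\sigma_1\cdots\sigma_{\ell-1},\,\sigma_\ell)$ on $\{0,1\}^n\times\Sigma$ satisfies $$H_\infty\bigl(x\sigma_1\cdots\sigma_{\ell-1},\,\sigma_\ell\bigr)\;\ge\;\log_2\bigl(2^n n^3\bigr)-B .$$ -/

import Mathlib

/-- The binary cube `{0,1}^n`. -/
abbrev Cube (n : ℕ) : Type := Fin n → Bool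

/-- The permutation `f_{i,J,h}` of the cube: XOR coordinate `i` with the Boolean function `h` of
the coordinates listed by the ordered set `J = (j_1, …, j_w)` of `w` indices different from `i`. -/
def simplePerm {w n : ℕ} (i : Fin n) (J : Fin w ↪ Fin n) (hJ : ∀ a, J a ≠ i)
    (h : (Fin w → Bool) → Bool) : Equiv.Perm (Cube n) :=
  Function.Involutive.toPerm
    (fun x : Cube n => Function.update x i (xor (x i) (h fun a => x (J a))))
    (by
      intro x
      funext k
      by_cases hk : k = i
      · subst hk
        simp [Function.update_of_ne (hJ _)]
      · simp [Function.update_of_ne hk])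

/-- The set of all width `w` simple permutations of `{0,1}^n`. -/
def simplePerms (w n : ℕ) : Set (Equiv.Perm (Cube n)) :=
  {σ | ∃ (i : Fin n) (J : Fin w ↪ Fin n) (hJ : ∀ a, J a ≠ i) (h : (Fin w → Bool) → Bool),
    σ = simplePerm i J hJ h}

/-- The width `2` simple permutations. As a type of permutations, its elements are equal when they
are equal as maps of the cube. -/
abbrev SimplePerm₂ (n : ℕ) : Type := ↥(simplePerms 2 n)

/-- The composition `σ_1 σ_2 ⋯ σ_m` of a list of permutations, where (permutations acting on the
right) `σ_1` is applied first. -/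
def composeList {X : Type*} (l : List (Equiv.Perm X)) : Equiv.Perm X :=
  l.foldl Equiv.trans (Equiv.refl X)

/-- The composition `σ_1 ⋯ σ_m` of the first `m` terms of a sequence of `L` width `2` simple
permutations. -/
def composePrefix {n L : ℕ} (ω : Fin L → SimplePerm₂ n) (m : ℕ) : Equiv.Perm (Cube n) :=
  composeList ((List.ofFn fun k => (ω k : Equiv.Perm (Cube n))).take m)

/-- A length `L` randomized implementation of `σ`: a random sequence of `L` width `2` simple
permutations whose composition is always `σ`. -/
structure RandomizedImplementation {n : ℕ} (σ : Equiv.Perm (Cube n)) (L : ℕ) where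
  /-- The joint distribution of `(σ_1, …, σ_L)`. -/
  law : PMF (Fin L → SimplePerm₂ n)
  compose_eq : ∀ ω ∈ law.support, composePrefix ω L = σ

/-- Ordered triples of distinct elements of the cube. -/
abbrev DistinctTriple (n : ℕ) : Type := Fin 3 ↪ Cube n

theorem distinctTriple_nonempty {n : ℕ} (hn : 3 ≤ n) : Nonempty (DistinctTriple n) := by
  apply Function.Embedding.nonempty_of_card_le
  have h : 2 ^ 3 ≤ 2 ^ n := Nat.pow_le_pow_right (by norm_num) hn
  simp only [Fintype.card_fin, Fintype.card_fun, Fintype.card_bool]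
  omega

/-- The uniform distribution on triples `(x, y, z)` of distinct elements of the cube. -/
noncomputable def uniformTriple (n : ℕ) (hn : 3 ≤ n) : PMF (DistinctTriple n) :=
  haveI := distinctTriple_nonempty hn
  PMF.uniformOfFintype (DistinctTriple n)

/-- The 3-cycle `(xyz)`, mapping `x ↦ y ↦ z ↦ x`. -/
def threeCycle {n : ℕ} (t : DistinctTriple n) : Equiv.Perm (Cube n) :=
  List.formPerm [t 0, t 1, t 2]

/-- The min-entropy `min_χ (- log₂ Pr[X = χ])` of a discrete random variable `X` with law `p`;
values `χ` of probability zero contribute `+∞` and are left out. -/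
noncomputable def minEntropy {α : Type*} (p : PMF α) : ℝ :=
  ⨅ χ : p.support, -Real.logb 2 (p (χ : α)).toReal

/-- Choose distinct `x, y, z` uniformly, then `σ_1, …, σ_L` from the randomized implementation of
`(xyz)`. This is the law of the pair `(x σ_1 ⋯ σ_{ℓ-1}, σ_ℓ)`. The index `ℓ : Fin L` starts at
`0`, so that `ℓ` permutations precede `ω ℓ`. -/
noncomputable def prefixLaw {n L : ℕ} (hn : 3 ≤ n)
    (R : (t : DistinctTriple n) → RandomizedImplementation (threeCycle t) L) (ℓ : Fin L) :
    PMF (Cube n × SimplePerm₂ n) :=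
  (uniformTriple n hn).bind fun t =>
    (R t).law.map fun ω => (composePrefix ω ℓ (t 0), ω ℓ)

/-! Take for every triple a fixed word of `40 * n` gates composing to its 3-cycle, and randomize
only by symmetry. The group of `2 ^ n * n!` coordinate permutations with shifts normalizes the set
of width-2 gates. For a uniform symmetry `g`, the implementation uses the word of the triple `g t`,
conjugated back by `g`. Since `t` is uniform, `g t` is uniform and independent of `g`, so at each
position the pair (current point, gate) is a uniformly random element of the orbit of a fixed pair
(`prefixLaw_symmetrize`).

The orbit is large when the gate depends on both of its controls: its action then reveals its target
and its unordered pair of controls, and the point fixes the shift. So at most `2 * (n - 3)!`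
symmetries produce a given pair (`card_symmetry_le`). This is why words are written in genuine
gates, at the cost of a factor 2 in length.

Linear length (`isComposition_threeCycle`) comes from moving the triple to a standard position and
using there a commutator of two multiply controlled NOTs, each built from linearly many Toffoli-type
gates with borrowed wires. -/

/-! ### Words of permutations and their lengths. -/

theorem composeList_append {X : Type*} (l l' : List (Equiv.Perm X)) :
    composeList (l ++ l') = (composeList l).trans (composeList l') := by
  induction l' using List.reverseRecOn with
  | nil => simp [composeList]
  | append_singleton l' τ ih =>
    have key : ∀ (m : List (Equiv.Perm X)), composeList (m ++ [τ]) = (composeList m).trans τ := by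
      intro m
      simp [composeList]
    rw [← List.append_assoc, key, ih, key, Equiv.trans_assoc]

theorem composeList_singleton {X : Type*} (τ : Equiv.Perm X) : composeList [τ] = τ := by
  simp [composeList]

theorem composeList_cons {X : Type*} (τ : Equiv.Perm X) (l : List (Equiv.Perm X)) :
    composeList (τ :: l) = τ.trans (composeList l) := by
  rw [← List.singleton_append, composeList_append, composeList_singleton]

theorem composeList_map_permCongr {X Y : Type*} (e : X ≃ Y) (l : List (Equiv.Perm X)) :
    composeList (l.map e.permCongr) = e.permCongr (composeList l) := by
  induction l with
  | nil => ext x; simp [composeList]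
  | cons τ l ih =>
    rw [List.map_cons, composeList_cons, composeList_cons, ih]
    ext x
    simp [Equiv.permCongr_apply]

/-- `σ` is a composition of exactly `m` permutations from `S`. -/
def IsComposition {X : Type*} (S : Set (Equiv.Perm X)) (m : ℕ) (σ : Equiv.Perm X) : Prop :=
  ∃ l : List (Equiv.Perm X), l.length = m ∧ (∀ τ ∈ l, τ ∈ S) ∧ composeList l = σ

namespace IsComposition

variable {X : Type*} {S T : Set (Equiv.Perm X)} {a b : ℕ} {σ τ : Equiv.Perm X}

theorem refl : IsComposition S 0 (Equiv.refl X) := ⟨[], rfl, by simp, rfl⟩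

theorem of_mem (h : σ ∈ S) : IsComposition S 1 σ :=
  ⟨[σ], rfl, by simpa using h, composeList_singleton σ⟩

theorem trans (hσ : IsComposition S a σ) (hτ : IsComposition S b τ) :
    IsComposition S (a + b) (σ.trans τ) := by
  obtain ⟨l, rfl, hl, rfl⟩ := hσ
  obtain ⟨l', rfl, hl', rfl⟩ := hτ
  refine ⟨l ++ l', by simp, ?_, composeList_append l l'⟩
  intro ρ hρ
  rcases List.mem_append.1 hρ with h | h
  exacts [hl ρ h, hl' ρ h]

theorem symm (hS : ∀ ρ ∈ S, ρ.symm ∈ S) (hσ : IsComposition S a σ) :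
    IsComposition S a σ.symm := by
  obtain ⟨l, rfl, hl, rfl⟩ := hσ
  induction l with
  | nil => exact refl
  | cons ρ l ih =>
    rw [composeList_cons, List.length_cons]
    have h := (ih fun τ hτ => hl τ (List.mem_cons_of_mem _ hτ)).trans
      (of_mem (hS ρ (hl ρ List.mem_cons_self)))
    exact h

/-- Padding with the identity; it gives the words of all triples one common length. -/
theorem mono (hS : Equiv.refl X ∈ S) (hab : a ≤ b) (hσ : IsComposition S a σ) :
    IsComposition S b σ := by
  induction hab with
  | refl => exact hσ
  | step _ ih => simpa using ih.trans (of_mem hS)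

theorem refine {c : ℕ} (hST : ∀ ρ ∈ S, IsComposition T c ρ) (hσ : IsComposition S a σ) :
    IsComposition T (a * c) σ := by
  obtain ⟨l, rfl, hl, rfl⟩ := hσ
  induction l with
  | nil =>
    rw [List.length_nil, Nat.zero_mul]
    exact refl
  | cons ρ l ih =>
    rw [composeList_cons, List.length_cons, Nat.succ_mul, add_comm]
    exact (hST ρ (hl ρ List.mem_cons_self)).trans
      (ih fun τ hτ => hl τ (List.mem_cons_of_mem _ hτ))

end IsComposition

/-! ### Width-2 gates and genuine gates. -/

/-- The gate XORing onto wire `i` the Boolean function `h` of the wires `j` and `k`. -/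
def gate {n : ℕ} (i j k : Fin n) (hij : j ≠ i) (hik : k ≠ i) (hjk : j ≠ k)
    (h : Bool → Bool → Bool) : Equiv.Perm (Cube n) :=
  simplePerm i ⟨![j, k], by
      intro a b hab
      fin_cases a <;> fin_cases b <;> simp_all⟩
    (by intro a; fin_cases a <;> simpa) (fun b => h (b 0) (b 1))

section gate

variable {n : ℕ} {i j k : Fin n} (hij : j ≠ i) (hik : k ≠ i) (hjk : j ≠ k)
  (h : Bool → Bool → Bool)

theorem gate_apply (x : Cube n) :
    gate i j k hij hik hjk h x = Function.update x i (xor (x i) (h (x j) (x k))) := rfl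

theorem gate_mem : gate i j k hij hik hjk h ∈ simplePerms 2 n :=
  ⟨i, _, _, _, rfl⟩

theorem gate_trans_gate (h' : Bool → Bool → Bool) :
    (gate i j k hij hik hjk h).trans (gate i j k hij hik hjk h') =
      gate i j k hij hik hjk fun a b => xor (h a b) (h' a b) := by
  ext x : 1
  simp [gate_apply, Function.update_of_ne hij, Function.update_of_ne hik]

end gate

theorem exists_eq_gate {n : ℕ} {τ : Equiv.Perm (Cube n)} (hτ : τ ∈ simplePerms 2 n) :
    ∃ (i j k : Fin n) (hij : j ≠ i) (hik : k ≠ i) (hjk : j ≠ k) (h : Bool → Bool → Bool),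
      τ = gate i j k hij hik hjk h := by
  obtain ⟨i, J, hJ, h, rfl⟩ := hτ
  refine ⟨i, J 0, J 1, hJ 0, hJ 1, fun e => by simpa using J.injective e,
    fun a b => h ![a, b], ?_⟩
  ext x : 1
  rw [gate_apply]
  change Function.update x i _ = _
  congr 3
  ext a
  fin_cases a <;> rfl

theorem symm_mem_simplePerms {n w : ℕ} : ∀ ρ ∈ simplePerms w n, ρ.symm ∈ simplePerms w n := by
  rintro _ ⟨i, J, hJ, h, rfl⟩
  exact ⟨i, J, hJ, h, rfl⟩

theorem exists_two_others {n : ℕ} (hn : 3 ≤ n) (i j : Fin n) :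
    ∃ k : Fin n, k ≠ i ∧ k ≠ j := by
  have h : ({i, j} : Finset (Fin n)).card < Fintype.card (Fin n) := by
    have := Finset.card_le_two (a := i) (b := j)
    simp only [Fintype.card_fin]
    omega
  obtain ⟨k, hk⟩ := Finset.exists_mem_notMem_of_card_lt_card
    (s := {i, j}) (t := Finset.univ) (by simpa using h)
  exact ⟨k, by simpa using hk⟩

theorem refl_mem_simplePerms {n : ℕ} (hn : 3 ≤ n) :
    Equiv.refl (Cube n) ∈ simplePerms 2 n := by
  obtain ⟨j, hj, -⟩ := exists_two_others hn ⟨0, by omega⟩ ⟨0, by omega⟩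
  obtain ⟨k, hk, hkj⟩ := exists_two_others hn ⟨0, by omega⟩ j
  convert gate_mem hj hk hkj.symm (fun _ _ => false)
  ext x : 1
  simp [gate_apply]

/-- The gates whose action depends on both of their control wires. -/
def genuineGates (n : ℕ) : Set (Equiv.Perm (Cube n)) :=
  {τ | ∃ (i j k : Fin n) (hij : j ≠ i) (hik : k ≠ i) (hjk : j ≠ k) (h : Bool → Bool → Bool),
    (∃ b, h false b ≠ h true b) ∧ (∃ a, h a false ≠ h a true) ∧ τ = gate i j k hij hik hjk h}

theorem mem_simplePerms_of_mem_genuineGates {n : ℕ} {τ : Equiv.Perm (Cube n)}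
    (hτ : τ ∈ genuineGates n) : τ ∈ simplePerms 2 n := by
  obtain ⟨i, j, k, hij, hik, hjk, h, -, -, rfl⟩ := hτ
  exact gate_mem hij hik hjk h

/-- Ten of the sixteen Boolean functions of two variables depend on both, so this set meets its
translate by `h`; the proof is a finite check. -/
theorem exists_genuine_xor (h : Bool → Bool → Bool) :
    ∃ h' : Bool → Bool → Bool, ((∃ b, h' false b ≠ h' true b) ∧ (∃ a, h' a false ≠ h' a true)) ∧
      (∃ b, xor (h' false b) (h false b) ≠ xor (h' true b) (h true b)) ∧
      (∃ a, xor (h' a false) (h a false) ≠ xor (h' a true) (h a true)) := by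
  revert h
  decide

/-- Degenerate gates, including the identities used as padding, are thereby eliminated from words.
-/
theorem isComposition_genuineGates {n : ℕ} {τ : Equiv.Perm (Cube n)}
    (hτ : τ ∈ simplePerms 2 n) : IsComposition (genuineGates n) 2 τ := by
  obtain ⟨i, j, k, hij, hik, hjk, h, rfl⟩ := exists_eq_gate hτ
  obtain ⟨h', ⟨h1, h2⟩, h3, h4⟩ := exists_genuine_xor h
  have := (IsComposition.of_mem (S := genuineGates n)
    ⟨i, j, k, hij, hik, hjk, h', h1, h2, rfl⟩).trans (IsComposition.of_mem
    ⟨i, j, k, hij, hik, hjk, fun a b => xor (h' a b) (h a b), h3, h4, rfl⟩)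
  rw [gate_trans_gate] at this
  simpa using this

theorem exists_gate_one_control {n : ℕ} (hn : 3 ≤ n) {i j : Fin n} (hij : j ≠ i)
    (h : Bool → Bool) :
    ∃ τ ∈ simplePerms 2 n, ∀ x, τ x = Function.update x i (xor (x i) (h (x j))) := by
  obtain ⟨k, hk, hkj⟩ := exists_two_others hn i j
  exact ⟨gate i j k hij hk hkj.symm fun a _ => h a, gate_mem _ _ _ _, fun _ => rfl⟩

/-! ### Moving three points to a standard position. -/

/-- If XORing `g` onto any single wire of `s` is a gate, and `g` does not depend on the wires of
`s`, then `g` can be XORed onto all wires of `s` by `#s` gates. -/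
theorem exists_fan {n : ℕ} (g : Cube n → Bool) (s : Finset (Fin n))
    (hg : ∀ i ∈ s, ∃ τ ∈ simplePerms 2 n, ∀ x, τ x = Function.update x i (xor (x i) (g x)))
    (hs : ∀ i ∈ s, ∀ x b, g (Function.update x i b) = g x) :
    ∃ σ, IsComposition (simplePerms 2 n) s.card σ ∧
      ∀ x k, σ x k = if k ∈ s then xor (x k) (g x) else x k := by
  induction s using Finset.induction_on with
  | empty => exact ⟨_, IsComposition.refl, by simp⟩
  | insert a s ha ih =>
    obtain ⟨σ, hσ, hσx⟩ := ih (fun i hi => hg i (Finset.mem_insert_of_mem hi))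
      (fun i hi => hs i (Finset.mem_insert_of_mem hi))
    obtain ⟨τ, hτ, hτx⟩ := hg a (Finset.mem_insert_self a s)
    refine ⟨τ.trans σ, ?_, ?_⟩
    · rw [Finset.card_insert_of_notMem ha, add_comm]
      exact (IsComposition.of_mem hτ).trans hσ
    · intro x k
      rw [Equiv.trans_apply, hσx, hτx, hs a (Finset.mem_insert_self a s)]
      by_cases hka : k = a
      · subst hka
        simp [ha]
      · simp [hka]

theorem exists_shift {n : ℕ} (hn : 3 ≤ n) (a : Cube n) :
    ∃ σ, IsComposition (simplePerms 2 n) n σ ∧ ∀ x k, σ x k = xor (x k) (a k) := by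
  obtain ⟨σ, hσ, h⟩ := exists_fan (fun _ => true) (Finset.univ.filter fun k => a k = true)
    (fun i _ => by
      obtain ⟨j, hj, -⟩ := exists_two_others hn i i
      exact exists_gate_one_control hn hj fun _ => true)
    (fun _ _ _ _ => rfl)
  refine ⟨σ, hσ.mono (refl_mem_simplePerms hn) ?_, fun x k => ?_⟩
  · simpa using Finset.card_le_univ (Finset.univ.filter fun k => a k = true)
  · rw [h]
    cases hak : a k <;> simp [hak]

/-- The cube point with a single `1`, at position `i`. -/
def unitPoint {n : ℕ} (i : Fin n) : Cube n := fun k => decide (k = i)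

/-- Wire `i` is XORed onto the other wires where `y` is `1`, which does nothing to points vanishing
on wire `i`. -/
theorem exists_clear {n : ℕ} (hn : 3 ≤ n) (i : Fin n) (y : Cube n) (hy : y i = true) :
    ∃ σ, IsComposition (simplePerms 2 n) n σ ∧ σ y = unitPoint i ∧
      ∀ x : Cube n, x i = false → σ x = x := by
  obtain ⟨σ, hσ, h⟩ := exists_fan (fun x => x i)
    (Finset.univ.filter fun k => k ≠ i ∧ y k = true)
    (fun k hk => exists_gate_one_control hn (by simp at hk; exact Ne.symm hk.1) id)
    (fun k hk x b => by
      simp only [Finset.mem_filter, Finset.mem_univ, true_and] at hk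
      exact Function.update_of_ne (Ne.symm hk.1) _ _)
  refine ⟨σ, hσ.mono (refl_mem_simplePerms hn) ?_, ?_, ?_⟩
  · simpa using Finset.card_le_univ (Finset.univ.filter fun k => k ≠ i ∧ y k = true)
  · ext k : 1
    rw [h]
    by_cases hk : k = i
    · subst hk
      simp [unitPoint, hy]
    · cases hyk : y k <;> simp [hk, hyk, hy, unitPoint]
  · intro x hx
    ext k : 1
    rw [h]
    simp [hx]

/-- If wire `i` of `y` is `0`, one gate copies wire `a` onto it before clearing. The fixed points
are what keeps already normalized points in place. -/
theorem exists_collect {n : ℕ} (hn : 3 ≤ n) (i a : Fin n) (y : Cube n) (hy : y a = true) :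
    ∃ σ, IsComposition (simplePerms 2 n) (1 + n) σ ∧ σ y = unitPoint i ∧
      ∀ x : Cube n, x a = false → x i = false → σ x = x := by
  cases hyi : y i
  · have hai : a ≠ i := by
      rintro rfl
      simp [hy] at hyi
    obtain ⟨τ, hτ, hτx⟩ := exists_gate_one_control hn hai id
    obtain ⟨σ, hσ, hσy, hσx⟩ := exists_clear hn i (τ y) (by simp [hτx, hy, hyi])
    refine ⟨τ.trans σ, (IsComposition.of_mem hτ).trans hσ, hσy, fun x hxa hxi => ?_⟩
    have hx : τ x = x := by simp [hτx, hxa]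
    rw [Equiv.trans_apply, hx, hσx x hxi]
  · obtain ⟨σ, hσ, hσy, hσx⟩ := exists_clear hn i y hyi
    exact ⟨σ, hσ.mono (refl_mem_simplePerms hn) (by omega), hσy, fun x _ hxi => hσx x hxi⟩

/-- Any three distinct points are moved by linearly many gates to the all-ones point and its
neighbours in two prescribed directions. -/
theorem exists_normalize {n : ℕ} (hn : 3 ≤ n) {i j : Fin n} (hij : i ≠ j) {x y z : Cube n}
    (hxy : x ≠ y) (hxz : x ≠ z) (hyz : y ≠ z) :
    ∃ σ, IsComposition (simplePerms 2 n) (4 * n + 2) σ ∧ σ x = (fun _ => true) ∧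
      σ y = (fun k => !unitPoint i k) ∧ σ z = (fun k => !unitPoint j k) := by
  obtain ⟨σ₁, h₁, hσ₁⟩ := exists_shift hn x
  have hx₁ : σ₁ x = fun _ => false := by
    ext k : 1
    simp [hσ₁]
  obtain ⟨a, ha⟩ : ∃ a, σ₁ y a = true := by
    by_contra! hcon
    refine hxy (σ₁.injective ?_)
    rw [hx₁]
    ext k : 1
    simpa using (hcon k)
  obtain ⟨σ₂, h₂, hσ₂y, hσ₂⟩ := exists_collect hn i a (σ₁ y) ha
  have hx₂ : σ₂ (fun _ => false) = fun _ => false := hσ₂ _ rfl rfl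
  -- The image of `z` differs from both the origin and `unitPoint i`, so it has a `1` off wire `i`.
  -- Collecting from `b` to `j` then fixes these two points, as they vanish on both wires.
  obtain ⟨b, hb, hbi⟩ : ∃ b, σ₂ (σ₁ z) b = true ∧ b ≠ i := by
    by_contra! hcon
    cases hzi : σ₂ (σ₁ z) i
    · refine hxz (σ₁.injective (σ₂.injective ?_))
      rw [hx₁, hx₂]
      ext k : 1
      cases hk : σ₂ (σ₁ z) k
      · rfl
      · rw [hcon k hk, hzi] at hk
        simp at hk
    · refine hyz (σ₁.injective (σ₂.injective ?_))
      rw [hσ₂y]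
      ext k : 1
      by_cases hki : k = i
      · simp [hki, unitPoint, hzi]
      · cases hk : σ₂ (σ₁ z) k
        · simp [unitPoint, hki]
        · exact absurd (hcon k hk) hki
  obtain ⟨σ₃, h₃, hσ₃z, hσ₃⟩ := exists_collect hn j b (σ₂ (σ₁ z)) hb
  obtain ⟨σ₄, h₄, hσ₄⟩ := exists_shift hn (fun _ => true)
  refine ⟨((σ₁.trans σ₂).trans σ₃).trans σ₄, ?_, ?_, ?_, ?_⟩
  · convert ((h₁.trans h₂).trans h₃).trans h₄ using 1
    ring
  · ext k : 1
    rw [Equiv.trans_apply, Equiv.trans_apply, Equiv.trans_apply, hx₁, hx₂, hσ₃ _ rfl rfl, hσ₄]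
    rfl
  · ext k : 1
    rw [Equiv.trans_apply, Equiv.trans_apply, Equiv.trans_apply, hσ₂y,
      hσ₃ _ (by simp [unitPoint, hbi]) (by simp [unitPoint, hij.symm]), hσ₄]
    simp
  · ext k : 1
    rw [Equiv.trans_apply, Equiv.trans_apply, Equiv.trans_apply, hσ₃z, hσ₄]
    simp

/-! ### Controlled NOTs with borrowed wires, and 3-cycles of linear length. -/

/-- The staircase of Toffoli gates: each wire `d j` with `j < k` gets XORed with the conjunction of
the wires `c 0, …, c (j + 1)`. -/
theorem exists_staircase {n : ℕ} (hn : 3 ≤ n) (c d : ℕ → Fin n) (k : ℕ) (hc : c 0 ≠ c 1)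
    (hd : ∀ j < k, ∀ j' < k, d j = d j' → j = j')
    (hcd : ∀ i ≤ k, ∀ j < k, c i ≠ d j) :
    ∃ σ, IsComposition (simplePerms 2 n) (2 * k) σ ∧
      ∀ x, (∀ w, (∀ j < k, w ≠ d j) → σ x w = x w) ∧
        ∀ j < k, σ x (d j) = xor (x (d j)) (decide (∀ l ≤ j + 1, x (c l) = true)) := by
  induction k with
  | zero => exact ⟨_, IsComposition.refl, fun x => ⟨fun _ _ => rfl, by simp⟩⟩
  | succ k ih =>
    rcases Nat.eq_zero_or_pos k with rfl | hk
    · have hG := gate_mem (hcd 0 (by omega) 0 (by omega)) (hcd 1 (by omega) 0 (by omega)) hc and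
      refine ⟨_, (IsComposition.of_mem hG).mono (refl_mem_simplePerms hn) (by omega),
        fun x => ⟨fun w hw => ?_, fun j hj => ?_⟩⟩
      · rw [gate_apply, Function.update_of_ne (hw 0 (by omega))]
      · obtain rfl : j = 0 := by omega
        rw [gate_apply, Function.update_self]
        congr 1
        rw [Bool.eq_iff_iff]
        simp [Nat.le_one_iff_eq_zero_or_eq_one]
    · obtain ⟨σ, hσ, hσx⟩ := ih (fun j hj j' hj' => hd j (by omega) j' (by omega))
        (fun i hi j hj => hcd i (by omega) j (by omega))
      have hdk : ∀ j < k, d k ≠ d j := fun j hj e => by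
        have := hd k (by omega) j (by omega) e
        omega
      have h1 : d (k - 1) ≠ d k := (hdk (k - 1) (by omega)).symm
      have h2 : c (k + 1) ≠ d k := hcd (k + 1) le_rfl k (by omega)
      have h3 : d (k - 1) ≠ c (k + 1) := (hcd (k + 1) le_rfl (k - 1) (by omega)).symm
      have hG := gate_mem h1 h2 h3 and
      set G := gate (d k) (d (k - 1)) (c (k + 1)) h1 h2 h3 and with hGdef
      have hGx : ∀ x w, w ≠ d k → G x w = x w := fun x w hw => by
        rw [hGdef, gate_apply, Function.update_of_ne hw]
      have hGd : ∀ x, G x (d k) = xor (x (d k)) (x (d (k - 1)) && x (c (k + 1))) := fun x => by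
        rw [hGdef, gate_apply, Function.update_self]
      have hcG : ∀ x, ∀ l ≤ k + 1, G x (c l) = x (c l) := fun x l hl =>
        hGx x _ (hcd l hl k (by omega))
      -- The two copies of `G` see wire `d (k - 1)` before and after `σ`. Its unknown initial value
      -- cancels, and only the conjunction added by `σ`, times `c (k + 1)`, reaches `d k`.
      refine ⟨(G.trans σ).trans G, ?_, fun x => ⟨fun w hw => ?_, fun j hj => ?_⟩⟩
      · convert ((IsComposition.of_mem hG).trans hσ).trans (IsComposition.of_mem hG) using 1
        ring
      · rw [Equiv.trans_apply, Equiv.trans_apply, hGx _ _ (hw k (by omega)),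
          (hσx _).1 w fun j hj => hw j (by omega), hGx _ _ (hw k (by omega))]
      · rw [Equiv.trans_apply, Equiv.trans_apply]
        rcases Nat.lt_succ_iff_lt_or_eq.1 hj with hjk | rfl
        · rw [hGx _ _ (hdk j hjk).symm, (hσx _).2 j hjk, hGx _ _ (hdk j hjk).symm]
          congr 2
          refine propext (forall_congr' fun l => forall_congr' fun hl => ?_)
          rw [hcG x l (by omega)]
        · rw [hGd, (hσx _).1 (d j) hdk, hGd, (hσx _).2 (j - 1) (by omega),
            (hσx _).1 (c (j + 1)) (fun i hi => hcd _ le_rfl i (by omega)), hGx _ _ h1,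
            hcG x _ le_rfl]
          have e1 : (∀ l ≤ j - 1 + 1, G x (c l) = true) ↔ ∀ l ≤ j, x (c l) = true := by
            rw [Nat.sub_add_cancel hk]
            refine forall_congr' fun l => forall_congr' fun hl => ?_
            rw [hcG x l (by omega)]
          have e2 : (∀ l ≤ j + 1, x (c l) = true) ↔
              (∀ l ≤ j, x (c l) = true) ∧ x (c (j + 1)) = true := by
            constructor
            · exact fun h => ⟨fun l hl => h l (by omega), h _ le_rfl⟩
            · rintro ⟨h, h'⟩ l hl
              rcases Nat.le_succ_iff.1 hl with hl | rfl
              exacts [h l hl, h']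
          simp only [e1, e2, Bool.decide_and, Bool.decide_eq_true]
          cases x (d j) <;> cases x (d (j - 1)) <;> cases x (c (j + 1)) <;>
            simp

/-- A multiply controlled NOT from linearly many gates, with borrowed wires. -/
theorem exists_controlled_not {n : ℕ} (hn : 3 ≤ n) (c d : ℕ → Fin n) (k : ℕ) (hc : c 0 ≠ c 1)
    (hd : ∀ j ≤ k, ∀ j' ≤ k, d j = d j' → j = j')
    (hcd : ∀ i ≤ k + 1, ∀ j ≤ k, c i ≠ d j) :
    ∃ σ, IsComposition (simplePerms 2 n) (4 * k + 2) σ ∧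
      ∀ x, σ x = Function.update x (d k)
        (xor (x (d k)) (decide (∀ l ≤ k + 1, x (c l) = true))) := by
  obtain ⟨σ, hσ, hσx⟩ := exists_staircase hn c d (k + 1) hc
    (fun j hj j' hj' => hd j (by omega) j' (by omega)) (fun i hi j hj => hcd i hi j (by omega))
  obtain ⟨τ, hτ, hτx⟩ := exists_staircase hn c d k hc
    (fun j hj j' hj' => hd j (by omega) j' (by omega))
    (fun i hi j hj => hcd i (by omega) j (by omega))
  -- The shorter staircase restores the wires `d j` with `j < k`, since the controls have not
  -- changed, and leaves the top wire `d k` alone.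
  refine ⟨σ.trans τ, ?_, fun x => ?_⟩
  · convert hσ.trans hτ using 1
    ring
  · ext w : 1
    rw [Equiv.trans_apply]
    have hdk : ∀ j < k, d k ≠ d j := fun j hj e => by
      have := hd k le_rfl j (by omega) e
      omega
    by_cases hw : w = d k
    · subst hw
      rw [(hτx _).1 _ hdk, (hσx _).2 k (by omega), Function.update_self]
    · rw [Function.update_of_ne hw]
      by_cases hj : ∃ j < k, w = d j
      · obtain ⟨j, hj, rfl⟩ := hj
        rw [(hτx _).2 j hj, (hσx _).2 j (by omega)]
        have e : (∀ l ≤ j + 1, σ x (c l) = true) ↔ ∀ l ≤ j + 1, x (c l) = true := by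
          refine forall_congr' fun l => forall_congr' fun hl => ?_
          rw [(hσx _).1 (c l) fun i hi => hcd l (by omega) i (by omega)]
        simp only [e, Bool.xor_assoc, Bool.xor_self, Bool.xor_false]
      · push Not at hj
        rw [(hτx _).1 w hj, (hσx _).1 w]
        intro j hjk
        rcases Nat.lt_succ_iff_lt_or_eq.1 hjk with h | rfl
        exacts [hj j h, hw]

/-- The commutator of two involutions whose supports share exactly one point is a 3-cycle. -/
theorem commutator_eq_formPerm {X : Type*} [DecidableEq X] (σ τ : Equiv.Perm X) (p : X)
    (hσ : ∀ x, σ (σ x) = x) (hτ : ∀ x, τ (τ x) = x) (hσp : σ p ≠ p) (hτp : τ p ≠ p)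
    (h : ∀ x, σ x ≠ x → τ x ≠ x → x = p) :
    ((σ.trans τ).trans σ).trans τ = List.formPerm [p, τ p, σ p] := by
  have hτσ : τ (σ p) = σ p := by
    by_contra hcon
    exact hσp (h _ (by rw [hσ]; exact hσp.symm) hcon)
  have hστ : σ (τ p) = τ p := by
    by_contra hcon
    exact hτp (h _ hcon (by rw [hτ]; exact hτp.symm))
  have hne : σ p ≠ τ p := by
    intro e
    rw [e, hτ] at hτσ
    exact hτp hτσ.symm
  ext x
  have hform : List.formPerm [p, τ p, σ p] x =
      Equiv.swap p (τ p) (Equiv.swap (τ p) (σ p) x) := by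
    simp [List.formPerm_cons_cons]
  rw [hform]
  simp only [Equiv.trans_apply]
  by_cases h1 : x = p
  · subst h1
    rw [hτσ, hσ, Equiv.swap_apply_of_ne_of_ne hτp.symm hσp.symm, Equiv.swap_apply_left]
  by_cases h2 : x = τ p
  · subst h2
    rw [hστ, hτ, hτσ, Equiv.swap_apply_left, Equiv.swap_apply_of_ne_of_ne hσp hne]
  by_cases h3 : x = σ p
  · subst h3
    rw [hσ, hστ, hτ, Equiv.swap_apply_right, Equiv.swap_apply_right]
  rw [Equiv.swap_apply_of_ne_of_ne h2 h3, Equiv.swap_apply_of_ne_of_ne h1 h2]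
  by_cases h4 : σ x = x
  · rw [h4]
    by_cases h5 : τ x = x
    · rw [h5, h4, h5]
    · have : σ (τ x) = τ x := by
        by_contra hcon
        refine h2 ?_
        rw [← h (τ x) hcon (by rw [hτ]; exact Ne.symm h5), hτ]
      rw [this, hτ]
  · have h5 : τ x = x := by
      by_contra hcon
      exact h1 (h x h4 hcon)
    have : τ (σ x) = σ x := by
      by_contra hcon
      refine h3 ?_
      rw [← h (σ x) (by rw [hσ]; exact Ne.symm h4) hcon, hσ]
    rw [this, hσ, h5]

/-- The 3-cycle on the all-ones point and its neighbours in some two directions. -/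
theorem exists_cycle_at_ones {n : ℕ} (hn : 3 ≤ n) :
    ∃ i j : Fin n, i ≠ j ∧ IsComposition (simplePerms 2 n) (8 * n)
      (List.formPerm [(fun _ => true : Cube n), fun k => !unitPoint i k,
        fun k => !unitPoint j k]) := by
  -- The lower bound on `n` makes room for `k + 2` controls, `k` borrowed wires and a target; the
  -- upper bound makes the first `k + 2` and the last `k + 2` wires cover everything.
  obtain ⟨k, hk1, hk2⟩ : ∃ k, 2 * k + 3 ≤ n ∧ n ≤ 2 * k + 4 := ⟨(n - 3) / 2, by omega, by omega⟩
  -- The minima only keep the values in range; they are inactive for the indices used.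
  let c : ℕ → Fin n := fun l => ⟨min l (n - 1), by omega⟩
  let d : ℕ → Fin n := fun l => ⟨min (k + 2 + l) (n - 1), by omega⟩
  have hc : ∀ l, (c l : ℕ) = min l (n - 1) := fun _ => rfl
  have hd : ∀ l, (d l : ℕ) = min (k + 2 + l) (n - 1) := fun _ => rfl
  have hcc : c 0 ≠ c 1 := by
    rw [Ne, Fin.ext_iff, hc, hc]
    omega
  have hdd : ∀ j ≤ k, ∀ j' ≤ k, d j = d j' → j = j' := by
    intro j hj j' hj' e
    rw [Fin.ext_iff, hd, hd] at e
    omega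
  have hcd : ∀ i ≤ k + 1, ∀ j ≤ k, c i ≠ d j := by
    intro i hi j hj
    rw [Ne, Fin.ext_iff, hc, hd]
    omega
  obtain ⟨σ, hσ, hσx⟩ := exists_controlled_not hn c d k hcc hdd hcd
  obtain ⟨τ, hτ, hτx⟩ := exists_controlled_not hn (fun l => Fin.rev (c l)) (fun l => Fin.rev (d l))
    k (fun e => hcc (Fin.rev_injective e))
    (fun j hj j' hj' e => hdd j hj j' hj' (Fin.rev_injective e))
    (fun i hi j hj e => hcd i hi j hj (Fin.rev_injective e))
  have hne : d k ≠ Fin.rev (d k) := by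
    rw [Ne, Fin.ext_iff, Fin.val_rev, hd]
    omega
  have flip : ∀ (i : Fin n) (C : Cube n → Prop) [DecidablePred C] (ρ : Equiv.Perm (Cube n)),
      (∀ x, ρ x = Function.update x i (xor (x i) (decide (C x)))) →
      (∀ x b, C (Function.update x i b) ↔ C x) → C (fun _ => true) →
      (∀ x, ρ (ρ x) = x) ∧ (∀ x, ρ x ≠ x → C x) ∧
        ρ (fun _ => true) = fun k => !unitPoint i k := by
    intro i C _ ρ hρ hC hC1
    refine ⟨fun x => ?_, fun x hx => ?_, ?_⟩
    · rw [hρ (ρ x), hρ x]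
      simp [hC]
    · by_contra hcon
      exact hx (by rw [hρ]; simp [hcon])
    · rw [hρ]
      ext w : 1
      by_cases hw : w = i
      · subst hw
        simp [unitPoint, hC1]
      · simp [unitPoint, hw]
  have hne1 : ∀ i : Fin n, (fun k => !unitPoint i k) ≠ (fun _ => true : Cube n) := fun i e => by
    simpa [unitPoint] using congrFun e i
  obtain ⟨s1, s2, s3⟩ := flip (d k) (fun x => ∀ l ≤ k + 1, x (c l) = true) σ hσx
    (fun x b => forall_congr' fun l => forall_congr' fun hl => by
      rw [Function.update_of_ne (hcd l hl k le_rfl)]) (fun _ _ => rfl)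
  obtain ⟨t1, t2, t3⟩ := flip (Fin.rev (d k)) (fun x => ∀ l ≤ k + 1, x (Fin.rev (c l)) = true)
    τ hτx (fun x b => forall_congr' fun l => forall_congr' fun hl => by
      rw [Function.update_of_ne fun e => hcd l hl k le_rfl (Fin.rev_injective e)])
    (fun _ _ => rfl)
  refine ⟨Fin.rev (d k), d k, hne.symm, ?_⟩
  rw [← s3, ← t3, ← commutator_eq_formPerm σ τ _ s1 t1 (by rw [s3]; exact hne1 _)
    (by rw [t3]; exact hne1 _) ?_]
  · exact (((hσ.trans hτ).trans hσ).trans hτ).mono (refl_mem_simplePerms hn) (by omega)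
  · intro x hxσ hxτ
    ext w : 1
    -- A point moved by both has ones on the controls of `σ` and on their mirror images, hence on
    -- all wires.
    by_cases hw : (w : ℕ) ≤ k + 1
    · have := s2 x hxσ w hw
      rwa [show c w = w from Fin.ext (by rw [hc]; omega)] at this
    · have := t2 x hxτ (n - 1 - w) (by omega)
      rwa [show Fin.rev (c (n - 1 - w)) = w from Fin.ext (by rw [Fin.val_rev, hc]; omega)] at this

theorem isComposition_threeCycle {n : ℕ} (hn : 3 ≤ n) (t : DistinctTriple n) :
    IsComposition (genuineGates n) (40 * n) (threeCycle t) := by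
  obtain ⟨i, j, hij, hcyc⟩ := exists_cycle_at_ones hn
  obtain ⟨ρ, hρ, h0, h1, h2⟩ := exists_normalize hn hij
    (x := t 0) (y := t 1) (z := t 2) (by simp) (by simp) (by simp)
  -- Conjugating a cycle relabels its entries.
  have key : (ρ.trans (List.formPerm [(fun _ => true : Cube n), fun k => !unitPoint i k,
      fun k => !unitPoint j k])).trans ρ.symm = threeCycle t := by
    rw [← h0, ← h1, ← h2]
    ext x : 1
    simp only [threeCycle, List.formPerm_cons_cons, List.formPerm_singleton, mul_one,
      Equiv.Perm.mul_apply, Equiv.trans_apply]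
    rw [Equiv.symm_apply_eq, Equiv.swap_apply_apply, Equiv.swap_apply_apply]
    simp
  rw [← key]
  -- The length is `2 * (4 * n + 2) + 8 * n ≤ 20 * n`; passing to genuine gates doubles it.
  have := ((hρ.trans hcyc).trans (hρ.symm symm_mem_simplePerms)).mono (b := 20 * n)
    (refl_mem_simplePerms hn) (by omega)
  convert this.refine (fun _ h => isComposition_genuineGates h) using 1
  ring

/-! ### Symmetries of the cube and their action on gates. -/

/-- The symmetry of the cube that permutes the coordinates and then shifts. -/
def cubeSymmetry {n : ℕ} (g : Equiv.Perm (Fin n) × Cube n) : Equiv.Perm (Cube n) where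
  toFun x k := xor (x (g.1 k)) (g.2 k)
  invFun y k := xor (y (g.1.symm k)) (g.2 (g.1.symm k))
  left_inv x := by ext k : 1; simp
  right_inv y := by ext k : 1; simp

theorem cubeSymmetry_apply {n : ℕ} (g : Equiv.Perm (Fin n) × Cube n) (x : Cube n) (k : Fin n) :
    cubeSymmetry g x k = xor (x (g.1 k)) (g.2 k) := rfl

/-- The permutation relabels the wires, and the shift is absorbed into `h`. -/
theorem permCongr_cubeSymmetry_mem {w n : ℕ} (g : Equiv.Perm (Fin n) × Cube n)
    {τ : Equiv.Perm (Cube n)} (hτ : τ ∈ simplePerms w n) :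
    (cubeSymmetry g).symm.permCongr τ ∈ simplePerms w n := by
  obtain ⟨i, J, hJ, h, rfl⟩ := hτ
  refine ⟨g.1 i, J.trans g.1.toEmbedding, fun a => by simpa using hJ a,
    fun b => h fun a => xor (b a) (g.2 (J a)), ?_⟩
  ext x : 1
  rw [Equiv.permCongr_apply, Equiv.symm_symm, Equiv.symm_apply_eq]
  ext k : 1
  rw [cubeSymmetry_apply]
  change Function.update (cubeSymmetry g x) i _ k = xor (Function.update x (g.1 i) _ (g.1 k)) _
  by_cases hk : k = i
  · subst hk
    simp [cubeSymmetry_apply, Bool.xor_comm]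
  · simp [hk, cubeSymmetry_apply]

/-- `τ` changes wire `i`. -/
def IsTarget {n : ℕ} (τ : Equiv.Perm (Cube n)) (i : Fin n) : Prop := ∃ x, τ x i ≠ x i

/-- Flipping wire `j` of the input changes some other wire of the output of `τ`. -/
def IsControl {n : ℕ} (τ : Equiv.Perm (Cube n)) (j : Fin n) : Prop :=
  ∃ x, ∃ i ≠ j, τ (Function.update x j (!x j)) i ≠ τ x i

section wires

variable {n : ℕ} {τ τ' : Equiv.Perm (Cube n)} {g : Equiv.Perm (Fin n) × Cube n}

theorem apply_cubeSymmetry (h : (cubeSymmetry g).symm.permCongr τ = τ') (x : Cube n) :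
    τ (cubeSymmetry g x) = cubeSymmetry g (τ' x) := by
  rw [← h, Equiv.permCongr_apply, Equiv.symm_symm, Equiv.apply_symm_apply]

/-- Targets and controls are defined through the action alone, so they are equivariant and do not
depend on how the gate is presented. -/
theorem isTarget_iff_of_permCongr (h : (cubeSymmetry g).symm.permCongr τ = τ') (i : Fin n) :
    IsTarget τ i ↔ IsTarget τ' (g.1 i) := by
  unfold IsTarget
  rw [(cubeSymmetry g).surjective.exists]
  simp [apply_cubeSymmetry h, cubeSymmetry_apply]

theorem isControl_iff_of_permCongr (h : (cubeSymmetry g).symm.permCongr τ = τ') (j : Fin n) :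
    IsControl τ j ↔ IsControl τ' (g.1 j) := by
  have hflip : ∀ x, Function.update (cubeSymmetry g x) j (!cubeSymmetry g x j) =
      cubeSymmetry g (Function.update x (g.1 j) (!x (g.1 j))) := by
    intro x
    ext k : 1
    by_cases hk : k = j
    · subst hk
      simp [cubeSymmetry_apply]
    · simp [hk, cubeSymmetry_apply]
  unfold IsControl
  rw [(cubeSymmetry g).surjective.exists]
  refine exists_congr fun x => ?_
  rw [g.1.surjective.exists (p := fun i => i ≠ g.1 j ∧ _), hflip]
  simp [apply_cubeSymmetry h, cubeSymmetry_apply]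

end wires

/-- The wires of a genuine gate can be read off its action. -/
theorem exists_wires {n : ℕ} {τ : Equiv.Perm (Cube n)} (hτ : τ ∈ genuineGates n) :
    ∃ e : Fin 3 ↪ Fin n, (∀ i, IsTarget τ i ↔ i = e 0) ∧
      ∀ j, IsControl τ j ↔ j = e 1 ∨ j = e 2 := by
  obtain ⟨i, j, k, hij, hik, hjk, h, ⟨b, hb⟩, ⟨a, ha⟩, rfl⟩ := hτ
  refine ⟨⟨![i, j, k], ?_⟩, fun l => ⟨?_, ?_⟩, fun l => ⟨?_, ?_⟩⟩
  · intro p q hpq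
    fin_cases p <;> fin_cases q <;> simp_all
  · rintro ⟨x, hx⟩
    by_contra hl
    exact hx (Function.update_of_ne hl _ _)
  · rintro rfl
    obtain ⟨p, q, hpq⟩ : ∃ p q, h p q = true := by
      by_contra! hcon
      exact hb (by simp [hcon])
    refine ⟨fun w => if w = j then p else q, ?_⟩
    simp [gate_apply, hjk.symm, hpq]
  · rintro ⟨x, m, hml, hx⟩
    by_contra! hcon
    change l ≠ j ∧ l ≠ k at hcon
    apply hx
    rw [gate_apply, gate_apply, Function.update_of_ne hcon.1.symm,
      Function.update_of_ne hcon.2.symm]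
    by_cases hm : m = i
    · subst hm
      simp [hml]
    · simp [hm, hml]
  · change l = j ∨ l = k → _
    rintro (rfl | rfl)
    · refine ⟨fun w => if w = l then false else b, i, hij.symm, ?_⟩
      simpa [gate_apply, hij.symm, hjk.symm] using hb.symm
    · refine ⟨fun w => if w = l then false else a, i, hik.symm, ?_⟩
      simpa [gate_apply, hik.symm, hjk] using ha.symm

/-! ### Counting the symmetries that produce a given pair. -/

open Classical in
-- By 3-transitivity, pick for each of the `n * (n - 1) * (n - 2)` ordered triples a permutation
-- carrying `f` to it. The resulting translates of the set are disjoint inside the symmetric group.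
theorem card_perm_extending_mul_le {n : ℕ} (e f : Fin 3 ↪ Fin n) :
    (Finset.univ.filter fun π : Equiv.Perm (Fin n) => ∀ a, π (e a) = f a).card *
      (n * (n - 1) * (n - 2)) ≤ n.factorial := by
  have htrans : ∀ f' : Fin 3 ↪ Fin n, ∃ ρ : Equiv.Perm (Fin n), ρ • f = f' := fun f' =>
    (Equiv.Perm.isMultiplyPretransitive (Fin n) 3).exists_smul_eq f f'
  choose ρ hρ using htrans
  have hinj : Set.InjOn (fun p : Equiv.Perm (Fin n) × (Fin 3 ↪ Fin n) => ρ p.2 * p.1)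
      ((Finset.univ.filter fun π : Equiv.Perm (Fin n) => ∀ a, π (e a) = f a) ×ˢ
        (Finset.univ : Finset (Fin 3 ↪ Fin n)) : Finset _) := by
    rintro ⟨π, f₁⟩ hπ ⟨π', f₂⟩ hπ' heq
    simp only [Finset.coe_product, Finset.coe_filter, Finset.mem_univ, true_and,
      Finset.coe_univ, Set.mem_prod, Set.mem_ofPred_eq, Set.mem_univ, and_true] at hπ hπ'
    have hf : f₁ = f₂ := by
      ext a : 1
      have := Equiv.congr_fun heq (e a)
      simp only [Equiv.Perm.mul_apply, hπ, hπ'] at this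
      rw [← hρ f₁, ← hρ f₂]
      exact this
    subst hf
    have : π = π' := mul_left_cancel heq
    rw [this]
  have := Finset.card_le_card_of_injOn _ (fun _ _ => Finset.mem_univ _) hinj
  rw [Finset.card_product, Finset.card_univ, Finset.card_univ, Fintype.card_perm,
    Fintype.card_fin, Fintype.card_embedding_eq] at this
  convert this using 2
  simp [Nat.descFactorial]
  ring

open Classical in
-- Conjugation to `τ'` determines the image of the target, and those of the two controls up to a
-- swap, whence the factor `2`. Given the permutation, `v` and `v'` determine the shift.
theorem card_symmetry_le {n : ℕ} {τ τ' : Equiv.Perm (Cube n)} (hτ : τ ∈ genuineGates n)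
    (v v' : Cube n) :
    (Finset.univ.filter fun g : Equiv.Perm (Fin n) × Cube n =>
      (cubeSymmetry g).symm v = v' ∧ (cubeSymmetry g).symm.permCongr τ = τ').card *
        (n * (n - 1) * (n - 2)) ≤ 2 * n.factorial := by
  set s := Finset.univ.filter fun g : Equiv.Perm (Fin n) × Cube n =>
      (cubeSymmetry g).symm v = v' ∧ (cubeSymmetry g).symm.permCongr τ = τ' with hs
  obtain ⟨e, he0, he⟩ := exists_wires hτ
  rcases s.eq_empty_or_nonempty with hempty | ⟨g₀, hg₀⟩
  · simp [hempty]
  have hmem : ∀ g, g ∈ s ↔ (cubeSymmetry g).symm v = v' ∧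
    (cubeSymmetry g).symm.permCongr τ = τ' := fun g => by
    rw [hs, Finset.mem_filter, and_iff_right (Finset.mem_univ g)]
  have hback : ∀ g ∈ s, ∀ g' ∈ s, ∀ i, (IsTarget τ i → IsTarget τ (g'.1.symm (g.1 i))) ∧
      (IsControl τ i → IsControl τ (g'.1.symm (g.1 i))) := by
    intro g hg g' hg' i
    have h1 := ((hmem g).1 hg).2
    have h2 := ((hmem g').1 hg').2
    rw [isTarget_iff_of_permCongr h1, isControl_iff_of_permCongr h1,
      isTarget_iff_of_permCongr h2, isControl_iff_of_permCongr h2, Equiv.apply_symm_apply]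
    exact ⟨id, id⟩
  let f : Fin 3 ↪ Fin n := e.trans g₀.1.toEmbedding
  let f' : Fin 3 ↪ Fin n := ((Equiv.swap (1 : Fin 3) 2).toEmbedding.trans e).trans g₀.1.toEmbedding
  have hsub : s.image Prod.fst ⊆
      (Finset.univ.filter fun π : Equiv.Perm (Fin n) => ∀ a, π (e a) = f a) ∪
      (Finset.univ.filter fun π : Equiv.Perm (Fin n) => ∀ a, π (e a) = f' a) := by
    intro π hπ
    obtain ⟨g, hg, rfl⟩ := Finset.mem_image.1 hπ
    have q0 : g.1 (e 0) = g₀.1 (e 0) := by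
      have := (hback g hg g₀ hg₀ (e 0)).1 ((he0 _).2 rfl)
      rwa [he0, Equiv.symm_apply_eq] at this
    have q1 := (hback g hg g₀ hg₀ (e 1)).2 ((he _).2 (Or.inl rfl))
    have q2 := (hback g hg g₀ hg₀ (e 2)).2 ((he _).2 (Or.inr rfl))
    rw [he, Equiv.symm_apply_eq, Equiv.symm_apply_eq] at q1 q2
    have q12 : g.1 (e 1) ≠ g.1 (e 2) := by simp
    rw [Finset.mem_union, Finset.mem_filter, Finset.mem_filter]
    rcases q1 with q1 | q1
    · have q2 : g.1 (e 2) = g₀.1 (e 2) := q2.resolve_left fun h => q12 (q1.trans h.symm)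
      refine Or.inl ⟨Finset.mem_univ _, fun a => ?_⟩
      fin_cases a
      exacts [q0, q1, q2]
    · have q2 : g.1 (e 2) = g₀.1 (e 1) := q2.resolve_right fun h => q12 (q1.trans h.symm)
      refine Or.inr ⟨Finset.mem_univ _, fun a => ?_⟩
      fin_cases a
      exacts [q0, q1, q2]
  have hcard : (s.image Prod.fst).card = s.card := by
    refine Finset.card_image_of_injOn ?_
    rintro ⟨π, a⟩ hg ⟨π', a'⟩ hg' (rfl : π = π')
    have h1 := ((hmem _).1 hg).1
    have h2 := ((hmem _).1 hg').1
    rw [Equiv.symm_apply_eq] at h1 h2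
    congr 1
    ext k : 1
    have := congrFun (h1.symm.trans h2) k
    simpa [cubeSymmetry_apply] using this
  rw [← hcard]
  calc _ ≤ ((Finset.univ.filter fun π : Equiv.Perm (Fin n) => ∀ a, π (e a) = f a).card +
      (Finset.univ.filter fun π : Equiv.Perm (Fin n) => ∀ a, π (e a) = f' a).card) *
        (n * (n - 1) * (n - 2)) := by
        gcongr
        exact (Finset.card_le_card hsub).trans (Finset.card_union_le _ _)
    _ ≤ _ := by
        rw [add_mul, two_mul]
        exact Nat.add_le_add (card_perm_extending_mul_le e f) (card_perm_extending_mul_le e f')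

/-! ### Randomization by symmetries and the min-entropy bound. -/

open scoped ENNReal

/-- The random conjugates of given words that implement 3-cycles. -/
noncomputable def symmetrize {n L : ℕ} (W : DistinctTriple n → Fin L → Equiv.Perm (Cube n))
    (hW : ∀ t k, W t k ∈ simplePerms 2 n)
    (hcomp : ∀ t, composeList (List.ofFn (W t)) = threeCycle t) (t : DistinctTriple n) :
    RandomizedImplementation (threeCycle t) L where
  law := (PMF.uniformOfFintype (Equiv.Perm (Fin n) × Cube n)).map fun g k =>
    ⟨(cubeSymmetry g).symm.permCongr (W (t.trans (cubeSymmetry g).toEmbedding) k),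
      permCongr_cubeSymmetry_mem g (hW _ k)⟩
  compose_eq := by
    intro ω hω
    rw [PMF.mem_support_map_iff] at hω
    obtain ⟨g, -, rfl⟩ := hω
    rw [composePrefix, List.take_of_length_le (by simp)]
    have : (List.ofFn fun k => (cubeSymmetry g).symm.permCongr
        (W (t.trans (cubeSymmetry g).toEmbedding) k)) =
        (List.ofFn (W (t.trans (cubeSymmetry g).toEmbedding))).map
          (cubeSymmetry g).symm.permCongr := by
      rw [List.map_ofFn]
      rfl
    rw [this, composeList_map_permCongr, hcomp]
    ext x : 1
    simp only [threeCycle, List.formPerm_cons_cons, List.formPerm_singleton, mul_one,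
      Equiv.permCongr_apply, Equiv.symm_symm, Equiv.Perm.mul_apply, Function.Embedding.trans_apply,
      Equiv.coe_toEmbedding]
    rw [Equiv.symm_apply_eq, Equiv.swap_apply_apply, Equiv.swap_apply_apply]
    simp

theorem map_uniformOfFintype_equiv {α : Type*} [Fintype α] [Nonempty α] (e : α ≃ α) :
    (PMF.uniformOfFintype α).map e = PMF.uniformOfFintype α := by
  classical
  ext a
  rw [PMF.map_apply, tsum_eq_single (e.symm a)]
  · simp
  · intro b hb
    rw [if_neg]
    rintro rfl
    simp at hb

theorem PMF.bind_apply_le {α β : Type*} (p : PMF α) (f : α → PMF β) (b : β) (C : ℝ≥0∞)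
    (h : ∀ a, f a b ≤ C) : p.bind f b ≤ C := by
  rw [PMF.bind_apply]
  calc ∑' a, p a * f a b ≤ ∑' a, p a * C := ENNReal.tsum_le_tsum fun a => by gcongr; exact h a
    _ = C := by rw [ENNReal.tsum_mul_right, p.tsum_coe, one_mul]

/-- For each fixed `g`, the triple `g t` is again uniform and can be renamed `t`. Afterwards `g`
acts on a prefix point and a gate that depend on `t` only. -/
theorem prefixLaw_symmetrize {n L : ℕ} (hn : 3 ≤ n)
    (W : DistinctTriple n → Fin L → Equiv.Perm (Cube n))
    (hW : ∀ t k, W t k ∈ simplePerms 2 n)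
    (hcomp : ∀ t, composeList (List.ofFn (W t)) = threeCycle t) (ℓ : Fin L) :
    prefixLaw hn (symmetrize W hW hcomp) ℓ = (uniformTriple n hn).bind fun t =>
      (PMF.uniformOfFintype (Equiv.Perm (Fin n) × Cube n)).map fun g =>
        ((cubeSymmetry g).symm (composeList ((List.ofFn (W t)).take ℓ) (t 0)),
          ⟨(cubeSymmetry g).symm.permCongr (W t ℓ), permCongr_cubeSymmetry_mem g (hW t ℓ)⟩) := by
  have := distinctTriple_nonempty hn
  have hu : ∀ g : Equiv.Perm (Fin n) × Cube n, uniformTriple n hn =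
      (uniformTriple n hn).map fun t => t.trans (cubeSymmetry g).toEmbedding := fun g =>
    (map_uniformOfFintype_equiv (Equiv.embeddingCongr (Equiv.refl _) (cubeSymmetry g))).symm
  simp only [prefixLaw, symmetrize, PMF.map_comp]
  simp only [← PMF.bind_pure_comp]
  rw [PMF.bind_comm, PMF.bind_comm (uniformTriple n hn)]
  congr 1
  ext1 g
  conv_rhs => rw [hu g, PMF.bind_map]
  congr 1
  ext1 t
  simp only [Function.comp_apply]
  congr 2
  have : (List.ofFn fun k => (cubeSymmetry g).symm.permCongr
      (W (t.trans (cubeSymmetry g).toEmbedding) k)) =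
      (List.ofFn (W (t.trans (cubeSymmetry g).toEmbedding))).map
        (cubeSymmetry g).symm.permCongr := by
    rw [List.map_ofFn]
    rfl
  rw [composePrefix, this, ← List.map_take, composeList_map_permCongr]
  simp

theorem symmetrized_apply_le {n : ℕ} (hn : 3 ≤ n) {τ : Equiv.Perm (Cube n)}
    (hτ : τ ∈ genuineGates n) (v : Cube n) (χ : Cube n × SimplePerm₂ n) :
    (PMF.uniformOfFintype (Equiv.Perm (Fin n) × Cube n)).map (fun g =>
      ((cubeSymmetry g).symm v, (⟨(cubeSymmetry g).symm.permCongr τ,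
        permCongr_cubeSymmetry_mem g (mem_simplePerms_of_mem_genuineGates hτ)⟩ : SimplePerm₂ n))) χ ≤
      ENNReal.ofReal (16 / (2 ^ n * n ^ 3)) := by
  classical
  rw [PMF.map_apply, tsum_fintype]
  refine (Finset.sum_congr rfl (g := fun g => if (cubeSymmetry g).symm v = χ.1 ∧
    (cubeSymmetry g).symm.permCongr τ = χ.2 then
      (Fintype.card (Equiv.Perm (Fin n) × Cube n) : ℝ≥0∞)⁻¹ else 0) fun g _ => ?_).trans_le ?_
  · rw [PMF.uniformOfFintype_apply]
    have hiff : χ = ((cubeSymmetry g).symm v, (⟨(cubeSymmetry g).symm.permCongr τ,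
        permCongr_cubeSymmetry_mem g (mem_simplePerms_of_mem_genuineGates hτ)⟩ :
          SimplePerm₂ n)) ↔
        (cubeSymmetry g).symm v = χ.1 ∧ (cubeSymmetry g).symm.permCongr τ = χ.2 := by
      rw [eq_comm, Prod.ext_iff, Subtype.ext_iff]
    by_cases h : (cubeSymmetry g).symm v = χ.1 ∧ (cubeSymmetry g).symm.permCongr τ = χ.2
    · rw [if_pos h, if_pos (hiff.2 h)]
    · rw [if_neg h, if_neg fun e => h (hiff.1 e)]
  rw [← Finset.sum_filter, Finset.sum_const, nsmul_eq_mul]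
  have hcard := card_symmetry_le hτ v χ.1 (τ' := χ.2)
  generalize (Finset.univ.filter fun g : Equiv.Perm (Fin n) × Cube n =>
        (cubeSymmetry g).symm v = χ.1 ∧ (cubeSymmetry g).symm.permCongr τ = χ.2).card = N
    at hcard ⊢
  have hG : Fintype.card (Equiv.Perm (Fin n) × Cube n) = n.factorial * 2 ^ n := by
    simp [Fintype.card_perm]
  have hpos : (0 : ℝ) < n.factorial * 2 ^ n := by positivity
  have hreal : (N : ℝ≥0∞) * (Fintype.card (Equiv.Perm (Fin n) × Cube n) : ℝ≥0∞)⁻¹ =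
      ENNReal.ofReal (N / (n.factorial * 2 ^ n)) := by
    rw [hG, ENNReal.ofReal_div_of_pos hpos, ENNReal.ofReal_natCast, div_eq_mul_inv]
    congr 2
    rw [← Nat.cast_two (R := ℝ), ← Nat.cast_pow, ← Nat.cast_mul, ENNReal.ofReal_natCast]
  rw [hreal]
  apply ENNReal.ofReal_le_ofReal
  have hn0 : (0 : ℝ) < n := by
    have : 0 < n := by omega
    exact_mod_cast this
  rw [div_le_div_iff₀ hpos (by positivity)]
  -- With the factor `2` for swapped controls, this gives the constant `16`.
  have hc : n ^ 3 ≤ 8 * (n * (n - 1) * (n - 2)) := by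
    obtain ⟨m, rfl⟩ := Nat.exists_eq_add_of_le hn
    rw [show 3 + m - 1 = m + 2 by omega, show 3 + m - 2 = m + 1 by omega]
    nlinarith [Nat.zero_le (m ^ 3), Nat.zero_le (m ^ 2)]
  have key : N * n ^ 3 ≤ 16 * n.factorial := by
    calc N * n ^ 3 ≤ N * (8 * (n * (n - 1) * (n - 2))) := Nat.mul_le_mul_left _ hc
      _ = 8 * (N * (n * (n - 1) * (n - 2))) := by ring
      _ ≤ 8 * (2 * n.factorial) := Nat.mul_le_mul_left _ hcard
      _ = _ := by ring
  have key' : (N : ℝ) * n ^ 3 ≤ 16 * n.factorial := by exact_mod_cast key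
  have := mul_le_mul_of_nonneg_right key' (by positivity : (0 : ℝ) ≤ 2 ^ n)
  linarith

theorem le_minEntropy {α : Type*} (p : PMF α) {M C : ℝ} (hM : 0 < M) (hC : 0 < C)
    (h : ∀ χ, p χ ≤ ENNReal.ofReal (C / M)) :
    Real.logb 2 M - Real.logb 2 C ≤ minEntropy p := by
  -- A real infimum over an empty index type would take the default value `0`.
  have : Nonempty p.support := p.support_nonempty.to_subtype
  refine le_ciInf fun χ => ?_
  have h0 : 0 < (p χ).toReal := ENNReal.toReal_pos ((p.mem_support_iff _).1 χ.2) (p.apply_ne_top _)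
  have h1 : (p χ).toReal ≤ C / M := ENNReal.toReal_le_of_le_ofReal (by positivity) (h χ)
  have := Real.logb_le_logb_of_le (b := 2) (by norm_num) h0 h1
  rw [Real.logb_div hC.ne' hM.ne'] at this
  linarith

theorem theorem9 :
    ∃ A B : ℝ, ∀ (n : ℕ) (hn : 3 ≤ n),
      ∃ L : ℕ, (L : ℝ) ≤ A * (n : ℝ) ∧
        ∃ R : (t : DistinctTriple n) → RandomizedImplementation (threeCycle t) L,
          ∀ ℓ : Fin L,
            Real.logb 2 ((2 : ℝ) ^ n * (n : ℝ) ^ 3) - B ≤ minEntropy (prefixLaw hn R ℓ) := by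
  refine ⟨40, Real.logb 2 16, fun n hn => ⟨40 * n, by push_cast; exact le_rfl, ?_⟩⟩
  have hword : ∀ t : DistinctTriple n, ∃ w : Fin (40 * n) → Equiv.Perm (Cube n),
      (∀ k, w k ∈ genuineGates n) ∧ composeList (List.ofFn w) = threeCycle t := by
    intro t
    obtain ⟨l, hl, hmem, hcomp⟩ := isComposition_threeCycle hn t
    refine ⟨fun k => l.get (k.cast hl.symm), fun k => hmem _ (List.get_mem _ _), ?_⟩
    rw [← hcomp]
    congr 1
    refine List.ext_get (by simp [hl]) fun _ _ _ => by simp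
  choose W hW hcomp using hword
  refine ⟨symmetrize W (fun t k => mem_simplePerms_of_mem_genuineGates (hW t k)) hcomp, fun ℓ => ?_⟩
  have hn0 : (0 : ℝ) < n := by
    have : 0 < n := by omega
    exact_mod_cast this
  refine le_minEntropy _ (by positivity) (by norm_num) fun χ => ?_
  rw [prefixLaw_symmetrize]
  exact PMF.bind_apply_le _ _ _ _ fun t => symmetrized_apply_le hn (hW t ℓ) _ χ
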